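/- For a discrete group $G$, let $C^*(G)$ denote its full group $C^*$-algebra, i.e. the completion of $\ell^1(G)$ (equivalently, of the group algebra $\mathbb{C}[G]$) in the norm $\|f\|_u=\sup_\pi\|\pi(f)\|$, where $\pi$ runs through the $*$-representations on Hilbert spaces (equivalently, the integrated forms of the unitary representations of $G$). A *group-lattice pair* $(G,A)$ consists of a group $G$ and a finitely generated abelian normal subgroup $A\trianglelefteq G$ of finite index; $G/A$ is called its *point group*. Let $\widehat{A}=\operatorname{Hom}(A,\mathbb{T})$, on which $G/A$ acts by $(gA\cdot\chi)(a)=\chi(g^{-1}ag)$. The pair $(G,A)$ is *crystal-like* if there is some $\chi\in\widehat{A}$ whose orbit $\mathcal{O}_\chi$ under this action satisfies $|\mathcal{O}_\chi|=[G:A]$. **Corollary.** Let $G$ and $H$ be discrete, finitely generated groups such that $C^*(G)\cong C^*(H)$ (as $C^*$-algebras, i.e. $*$-isomorphic). If $(G,A_G)$ and $(H,A_H)$ are crystal-like group-lattice pairs, then $[G:A_G]=[H:A_H]$; that is, the point groups $G/A_G$ and $H/A_H$ have the same order. -/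

import Mathlib

open scoped ENNReal

noncomputable section

universe u

/-- A unitary representation of the discrete group `G` on a non-zero complex Hilbert space.
The Hilbert spaces range over the universe of `G`. This is no restriction on the universal norm
below: a cyclic representation of `G` is a completion of a quotient of the group algebra `ℂ[G]`,
so it has a copy in the universe of `G`, and the norm of `π(f)` is the supremum of the norms of its
restrictions to the cyclic subrepresentations of `π`. -/
structure UnitaryRep (G : Type u) [Group G] : Type (u + 1) where
  space : Type u
  [normedAddCommGroup : NormedAddCommGroup space]
  [innerProductSpace : InnerProductSpace ℂ space]
  [completeSpace : CompleteSpace space]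
  [nontrivial : Nontrivial space]
  hom : G →* unitary (space →L[ℂ] space)

namespace UnitaryRep

attribute [instance] normedAddCommGroup innerProductSpace completeSpace nontrivial

variable {G : Type u} [Group G]

/-- The bounded operators on the space of the representation. -/
abbrev Op (π : UnitaryRep G) : Type u := π.space →L[ℂ] π.space

/-- The extension of a unitary representation to the group algebra:
`π(f) = ∑ g, f(g) π(g)`. -/
def integrated (π : UnitaryRep G) : MonoidAlgebra ℂ G →ₐ[ℂ] π.Op :=
  MonoidAlgebra.lift ℂ π.Op G ((unitary π.Op).subtype.comp π.hom)

end UnitaryRep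

section GroupCStar

variable (G : Type u) [Group G]

/-- The C*-algebra of all bounded families `(T_π)`, `T_π ∈ B(H_π)`, with the supremum norm and
pointwise operations; `π` runs through all unitary representations of `G`. -/
def UniversalOp : Type (u + 1) := lp (fun π : UnitaryRep G => π.Op) ∞

namespace UniversalOp

instance : NormedRing (UniversalOp G) :=
  inferInstanceAs (NormedRing (lp (fun π : UnitaryRep G => π.Op) ∞))

instance : StarRing (UniversalOp G) :=
  inferInstanceAs (StarRing (lp (fun π : UnitaryRep G => π.Op) ∞))

instance : NormedAlgebra ℂ (UniversalOp G) :=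
  inferInstanceAs (NormedAlgebra ℂ (lp (fun π : UnitaryRep G => π.Op) ∞))

instance : CompleteSpace (UniversalOp G) :=
  inferInstanceAs (CompleteSpace (lp (fun π : UnitaryRep G => π.Op) ∞))

instance : CStarRing (UniversalOp G) :=
  inferInstanceAs (CStarRing (lp (fun π : UnitaryRep G => π.Op) ∞))

instance : StarModule ℂ (UniversalOp G) :=
  inferInstanceAs (StarModule ℂ (lp (fun π : UnitaryRep G => π.Op) ∞))

instance : CStarAlgebra (UniversalOp G) where

variable {G}

/-- The component at `π` of a bounded family of operators. -/
def component (π : UnitaryRep G) : UniversalOp G →⋆ₐ[ℂ] π.Op where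
  toFun T := (show lp (fun π : UnitaryRep G => π.Op) ∞ from T) π
  map_one' := rfl
  map_mul' _ _ := rfl
  map_zero' := rfl
  map_add' _ _ := rfl
  commutes' _ := rfl
  map_star' _ := rfl

theorem ext {S T : UniversalOp G} (h : ∀ π, component π S = component π T) : S = T :=
  lp.ext (funext h)

theorem norm_eq (T : UniversalOp G) : ‖T‖ = ⨆ π, ‖component π T‖ :=
  lp.norm_eq_ciSup _

theorem bddAbove_norm (T : UniversalOp G) : BddAbove (Set.range fun π => ‖component π T‖) :=
  memℓp_infty_iff.mp (lp.memℓp (show lp (fun π : UnitaryRep G => π.Op) ∞ from T))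

end UniversalOp

open UniversalOp

variable {G} in
/-- The universal representation of a group element: the family `(π(g))_π`. -/
def universalRep : G →* UniversalOp G where
  toFun g := (⟨fun π => (π.hom g : π.Op), memℓp_infty ⟨1, by
    rintro _ ⟨π, rfl⟩
    exact (CStarRing.norm_coe_unitary (π.hom g)).le⟩⟩ : lp (fun π : UnitaryRep G => π.Op) ∞)
  map_one' := UniversalOp.ext fun π => by
    exact congrArg Subtype.val (map_one π.hom)
  map_mul' g h := UniversalOp.ext fun π => by
    exact congrArg Subtype.val (map_mul π.hom g h)

variable {G} in
theorem component_universalRep (π : UnitaryRep G) (g : G) :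
    component π (universalRep g) = (π.hom g : π.Op) := rfl

/-- The *-subalgebra underlying `C*(G)`: the norm closure, in the universal representation, of the
*-algebra generated by `G`. -/
def groupCStarSubalgebra : StarSubalgebra ℂ (UniversalOp G) :=
  (StarAlgebra.adjoin ℂ (Set.range (universalRep (G := G)))).topologicalClosure

instance isClosed_groupCStarSubalgebra :
    IsClosed (groupCStarSubalgebra G : Set (UniversalOp G)) :=
  StarSubalgebra.isClosed_topologicalClosure _

/-- The full group C*-algebra `C*(G)` of the discrete group `G`: the closure of the group algebra
`ℂ[G]` in the universal representation (see `coe_groupCStarSubalgebra`). The norm on `ℂ[G]` is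
`‖f‖ = sup_π ‖π(f)‖` (see `norm_universalRepAlg`), so this is the completion of `ℂ[G]`,
equivalently of `ℓ¹(G)`, in the universal norm. -/
def GroupCStar : Type (u + 1) := groupCStarSubalgebra G

instance : CStarAlgebra (GroupCStar G) :=
  inferInstanceAs (CStarAlgebra (groupCStarSubalgebra G))

/-- The inclusion of `C*(G)` in the bounded families of operators. -/
def GroupCStar.incl : GroupCStar G →⋆ₐ[ℂ] UniversalOp G where
  toFun x := (show groupCStarSubalgebra G from x).1
  map_one' := rfl
  map_mul' _ _ := rfl
  map_zero' := rfl
  map_add' _ _ := rfl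
  commutes' _ := rfl
  map_star' _ := rfl

theorem GroupCStar.isometry_incl : Isometry (GroupCStar.incl G) := fun _ _ => rfl

theorem GroupCStar.range_incl :
    Set.range (GroupCStar.incl G) = (groupCStarSubalgebra G : Set (UniversalOp G)) :=
  Subtype.range_coe

/-- The universal representation of the group algebra. -/
def universalRepAlg : MonoidAlgebra ℂ G →ₐ[ℂ] UniversalOp G :=
  MonoidAlgebra.lift ℂ (UniversalOp G) G universalRep

variable {G}

theorem component_universalRepAlg (f : MonoidAlgebra ℂ G) (π : UnitaryRep G) :
    component π (universalRepAlg G f) = π.integrated f := by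
  induction f using MonoidAlgebra.induction_on with
  | of g => simp [universalRepAlg, UnitaryRep.integrated, component_universalRep]
  | add f h hf hh => simp only [map_add, hf, hh]
  | smul r f hf => simp only [map_smul, hf]

/-- The norm of `C*(G)` restricted to the group algebra is the universal norm. -/
theorem norm_universalRepAlg (f : MonoidAlgebra ℂ G) :
    ‖universalRepAlg G f‖ = ⨆ π : UnitaryRep G, ‖π.integrated f‖ := by
  simp only [UniversalOp.norm_eq, component_universalRepAlg]

/-- The supremum in the universal norm is that of a bounded set. -/
theorem bddAbove_norm_integrated (f : MonoidAlgebra ℂ G) :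
    BddAbove (Set.range fun π : UnitaryRep G => ‖π.integrated f‖) := by
  simpa only [component_universalRepAlg] using UniversalOp.bddAbove_norm (universalRepAlg G f)

theorem star_universalRep (g : G) : star (universalRep g) = universalRep g⁻¹ :=
  UniversalOp.ext fun π => by
    rw [map_star, component_universalRep, component_universalRep, map_inv]
    rfl

/-- `C*(G)` is the closure of the image of the group algebra. -/
theorem coe_groupCStarSubalgebra :
    (groupCStarSubalgebra G : Set (UniversalOp G)) = closure (Set.range (universalRepAlg G)) := by
  have hstar : star (Set.range (universalRep (G := G))) = Set.range universalRep := by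
    ext x
    constructor
    · rintro ⟨g, hg⟩
      exact ⟨g⁻¹, by rw [← star_star x, ← hg, star_universalRep]⟩
    · rintro ⟨g, rfl⟩
      exact ⟨g⁻¹, (star_universalRep g).symm⟩
  have hadj : ((StarAlgebra.adjoin ℂ (Set.range (universalRep (G := G)))).toSubalgebra) =
      (universalRepAlg G).range := by
    rw [StarAlgebra.adjoin_toSubalgebra, hstar, Set.union_self]
    apply le_antisymm
    · rw [Algebra.adjoin_le_iff]
      rintro _ ⟨g, rfl⟩
      exact ⟨MonoidAlgebra.of ℂ G g, by simp [universalRepAlg]⟩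
    · rintro _ ⟨f, rfl⟩
      induction f using MonoidAlgebra.induction_on with
      | of g => exact Algebra.subset_adjoin ⟨g, by simp [universalRepAlg]⟩
      | add f h hf hh => simpa using add_mem hf hh
      | smul r f hf => simpa using Subalgebra.smul_mem _ hf r
  have h := congrArg (fun S : Subalgebra ℂ (UniversalOp G) => (S : Set (UniversalOp G))) hadj
  rw [groupCStarSubalgebra, StarSubalgebra.topologicalClosure_coe]
  exact congrArg closure h

end GroupCStar

/-- A group-lattice pair `(G, A)`: a finitely generated abelian normal subgroup `A` (the lattice)
of finite index in `G`. -/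
structure GroupLatticePair (G : Type u) [Group G] where
  lattice : Subgroup G
  [normal : lattice.Normal]
  [isMulCommutative : IsMulCommutative lattice]
  [finiteIndex : lattice.FiniteIndex]
  fg : lattice.FG

namespace GroupLatticePair

attribute [instance] normal isMulCommutative finiteIndex

variable {G : Type u} [Group G] (P : GroupLatticePair G)

/-- The point group `D = G ⧸ A`. -/
abbrev pointGroup : Type u := G ⧸ P.lattice

/-- The dual `Hom(A, 𝕋)` of the (discrete) lattice. -/
abbrev Dual : Type u := P.lattice →* Circle

/-- The conjugation action of `G` on the dual: `(g • χ)(a) = χ(g⁻¹ a g)`. -/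
def conjDual : G →* Equiv.Perm P.Dual where
  toFun g :=
    { toFun := fun χ => χ.comp (MulAut.conjNormal g⁻¹).toMonoidHom
      invFun := fun χ => χ.comp (MulAut.conjNormal g).toMonoidHom
      left_inv := fun χ => by ext a; simp [map_inv]
      right_inv := fun χ => by ext a; simp [map_inv] }
  map_one' := by ext χ a; simp
  map_mul' g h := by ext χ a; simp

theorem conjDual_apply (g : G) (χ : P.Dual) (a : P.lattice) :
    P.conjDual g χ a =
      χ ⟨g⁻¹ * a * g, by simpa using P.normal.conj_mem a a.2 g⁻¹⟩ := by
  refine congrArg χ (Subtype.ext ?_)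
  simp

/-- The lattice acts trivially, so the action descends to the point group. -/
def pointGroupAction : P.pointGroup →* Equiv.Perm P.Dual :=
  QuotientGroup.lift P.lattice P.conjDual (fun g hg => by
    ext χ a
    rw [conjDual_apply]
    congr 2
    apply Subtype.ext
    have h : (⟨g, hg⟩ : P.lattice) * a = a * ⟨g, hg⟩ := mul_comm' _ _
    have h' : g * (a : G) = a * g := congrArg Subtype.val h
    simp [mul_assoc, ← h'])

/-- The orbit of a character under the action of the point group. -/
def orbit (χ : P.Dual) : Set P.Dual := Set.range fun d : P.pointGroup => P.pointGroupAction d χ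

/-- The pair is crystal-like if some character of the lattice has an orbit with `[G : A]`
elements. -/
def IsCrystalLike : Prop := ∃ χ : P.Dual, (P.orbit χ).ncard = P.lattice.index

end GroupLatticePair

end

/-!
An irreducible finite-dimensional representation `V` of a group with an abelian subgroup `A` of
finite index has dimension at most the index: a common eigenvector `v` of `A` exists, and the
translates of `v` by coset representatives of `A` span `V`. If `A` is normal and a character of `A`
has trivial stabilizer in the point group, the bound is attained by the induced representation:
`A` acts on its coordinate lines by distinct, hence linearly independent, characters, so an
invariant subspace contains the coordinate components of its vectors, and `G` permutes the lines
transitively. As `G` spans a dense subspace of `C*(G)`, irreducibility in finite dimension is the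
same for `G` and for `C*(G)`, so the index is the largest dimension of a finite-dimensional
irreducible representation of `C*(G)`.
-/

section IrreducibleRepresentations

open Module

variable {k G V : Type*} [Field k] [AddCommGroup V] [Module k V]

/-- The subrepresentation of `ρ` generated by the vector `v`. -/
def cyclicSubrepresentation [Monoid G] (ρ : Representation k G V) (v : V) :
    Subrepresentation ρ where
  toSubmodule := Submodule.span k (Set.range fun g => ρ g v)
  apply_mem_toSubmodule g w hw := by
    induction hw using Submodule.span_induction with
    | mem w hw =>
      obtain ⟨h, rfl⟩ := hw
      exact Submodule.subset_span ⟨g * h, by simp⟩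
    | zero => simp
    | add w w' _ _ h h' => simpa using add_mem h h'
    | smul c w _ h => simpa using Submodule.smul_mem _ c h

theorem mem_cyclicSubrepresentation_self [Monoid G] (ρ : Representation k G V) (v : V) :
    v ∈ cyclicSubrepresentation ρ v :=
  Submodule.subset_span ⟨1, by simp⟩

theorem cyclicSubrepresentation_le [Monoid G] {ρ : Representation k G V} {S : Subrepresentation ρ}
    {v : V} (hv : v ∈ S) : cyclicSubrepresentation ρ v ≤ S :=
  Submodule.span_le.mpr (Set.range_subset_iff.mpr fun g => S.apply_mem_toSubmodule g hv)

theorem isIrreducible_iff_forall_cyclicSubrepresentation_eq_top [Monoid G]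
    {ρ : Representation k G V} :
    ρ.IsIrreducible ↔ Nontrivial V ∧ ∀ v ≠ 0, cyclicSubrepresentation ρ v = ⊤ := by
  have hbot : ∀ {v : V}, v ∈ (⊥ : Subrepresentation ρ) ↔ v = 0 := Submodule.mem_bot k
  constructor
  · intro h
    refine ⟨?_, fun v hv => (eq_bot_or_eq_top _).resolve_left fun hcyc => hv ?_⟩
    · by_contra! hV
      exact bot_ne_top (Subrepresentation.toSubmodule_injective
        (Subsingleton.elim (⊥ : Subrepresentation ρ).toSubmodule ⊤))
    · exact hbot.mp (hcyc ▸ mem_cyclicSubrepresentation_self ρ v)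
  · rintro ⟨_, hcyc⟩
    refine { exists_pair_ne := ⟨⊥, ⊤, fun h => bot_ne_top (α := Submodule k V)
      (congrArg Subrepresentation.toSubmodule h)⟩, eq_bot_or_eq_top := fun S => ?_ }
    refine or_iff_not_imp_right.mpr fun hS => Subrepresentation.toSubmodule_injective ?_
    refine (Submodule.eq_bot_iff _).mpr fun v hv => by_contra fun hv0 => hS ?_
    exact top_unique (hcyc v hv0 ▸ cyclicSubrepresentation_le hv)

open scoped IsMulCommutative in
theorem exists_common_eigenvector [IsAlgClosed k] [FiniteDimensional k V] [Nontrivial V] [Monoid G]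
    [IsMulCommutative G] (ρ : Representation k G V) :
    ∃ v : V, v ≠ 0 ∧ ∀ g, ∃ c : k, ρ g v = c • v := by
  have : FiniteDimensional k ρ.asModule := ‹FiniteDimensional k V›
  have : Nontrivial ρ.asModule := ‹Nontrivial V›
  have : IsArtinian (MonoidAlgebra k G) ρ.asModule := isArtinian_of_tower k inferInstance
  obtain ⟨N, hN⟩ := IsAtomic.exists_atom (Submodule (MonoidAlgebra k G) ρ.asModule)
  have : IsSimpleModule (MonoidAlgebra k G) N := isSimpleModule_iff_isAtom.mpr hN
  have : FiniteDimensional k N := inferInstanceAs (FiniteDimensional k (N.restrictScalars k))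
  have hdim : finrank k N = 1 :=
    IsSimpleModule.finrank_eq_one_of_isMulCommutative (MonoidAlgebra k G) N k
  obtain ⟨v, hv⟩ := finrank_pos_iff_exists_ne_zero.mp (hdim ▸ zero_lt_one)
  refine ⟨ρ.asModuleEquiv v, fun h => hv (Subtype.ext h), fun g => ?_⟩
  obtain ⟨c, hc⟩ :=
    (finrank_eq_one_iff_of_nonzero' v hv).mp hdim (MonoidAlgebra.single g (1 : k) • v)
  refine ⟨c, ?_⟩
  simpa only [Submodule.coe_smul, Representation.single_smul, one_smul] using!
    (congrArg Subtype.val hc).symm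

theorem finrank_le_index_of_isIrreducible [IsAlgClosed k] [FiniteDimensional k V] [Group G]
    {ρ : Representation k G V} (hρ : ρ.IsIrreducible) (A : Subgroup G) [IsMulCommutative A]
    [A.FiniteIndex] : finrank k V ≤ A.index := by
  obtain ⟨_, hcyc⟩ := isIrreducible_iff_forall_cyclicSubrepresentation_eq_top.mp hρ
  obtain ⟨v, hv, heigen⟩ := exists_common_eigenvector (ρ.comp A.subtype)
  have hcosets : Submodule.span k (Set.range fun x : G ⧸ A => ρ x.out v) = ⊤ := by
    refine top_unique ?_
    rw [← show (cyclicSubrepresentation ρ v).toSubmodule = ⊤ from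
      congrArg Subrepresentation.toSubmodule (hcyc v hv)]
    refine Submodule.span_le.mpr (Set.range_subset_iff.mpr fun g => ?_)
    obtain ⟨a, ha⟩ := QuotientGroup.mk_out_eq_mul A g
    obtain ⟨c, hc⟩ := heigen a⁻¹
    have hg : ρ g v = c • ρ (g : G ⧸ A).out v := by
      rw [eq_mul_inv_of_mul_eq ha.symm, map_mul, Module.End.mul_apply, ← map_smul, ← hc]
      simp
    rw [hg]
    exact Submodule.smul_mem _ c (Submodule.subset_span ⟨_, rfl⟩)
  let _ := A.fintypeQuotientOfFiniteIndex
  calc finrank k V = finrank k (⊤ : Submodule k V) := (finrank_top k V).symm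
    _ ≤ Fintype.card (G ⧸ A) := hcosets ▸ finrank_range_le_card _
    _ = A.index := Nat.card_eq_fintype_card.symm

theorem span_range_apply_eq_top {A X : Type*} [Monoid A] [Finite X] {ψ : X → A →* k}
    (hψ : Function.Injective ψ) :
    Submodule.span k (Set.range fun (a : A) (x : X) => ψ x a) = ⊤ :=
  span_flip_eq_top_iff_linearIndependent.mpr ((linearIndependent_monoidHom A k).comp ψ hψ)

theorem repr_smul_mem_cyclicSubrepresentation {X : Type*} [Finite X] [Monoid G]
    {ρ : Representation k G V} (b : Basis X k V) {ψ : X → G →* k} (hψ : Function.Injective ψ)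
    (hdiag : ∀ g x, ρ g (b x) = ψ x g • b x) (v : V) (x : X) :
    b.repr v x • b x ∈ cyclicSubrepresentation ρ v := by
  classical
  have := Fintype.ofFinite X
  let T : (X → k) →ₗ[k] V := Fintype.linearCombination k fun x => b.repr v x • b x
  have hT : ∀ g, T (fun x => ψ x g) = ρ g v := fun g => by
    conv_rhs => rw [← b.sum_repr v]
    simp only [T, Fintype.linearCombination_apply, map_sum, map_smul, hdiag]
    exact Finset.sum_congr rfl fun x _ => smul_comm _ _ _
  have hrange : LinearMap.range T = (cyclicSubrepresentation ρ v).toSubmodule := by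
    rw [LinearMap.range_eq_map, ← span_range_apply_eq_top hψ, Submodule.map_span, ← Set.range_comp]
    exact congrArg (Submodule.span k <| Set.range ·) (funext hT)
  change b.repr v x • b x ∈ (cyclicSubrepresentation ρ v).toSubmodule
  rw [← hrange]
  exact ⟨Pi.single x 1, by simp [T]⟩

theorem isIrreducible_of_monomial {A X : Type*} [Finite X] [Nonempty X] [Monoid A] [Monoid G]
    {ρ : Representation k G V} (b : Basis X k V) (ι : A →* G) {ψ : X → A →* k}
    (hψ : Function.Injective ψ) (hdiag : ∀ a x, ρ (ι a) (b x) = ψ x a • b x)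
    (htrans : ∀ x y, ∃ g, ∃ c : k, c ≠ 0 ∧ ρ g (b x) = c • b y) : ρ.IsIrreducible := by
  refine isIrreducible_iff_forall_cyclicSubrepresentation_eq_top.mpr
    ⟨b.repr.toEquiv.nontrivial, fun v hv => Subrepresentation.toSubmodule_injective ?_⟩
  set W := (cyclicSubrepresentation ρ v).toSubmodule
  obtain ⟨x, hx⟩ : ∃ x, b.repr v x ≠ 0 := by
    by_contra! h
    exact hv (b.repr.map_eq_zero_iff.mp (Finsupp.ext h))
  have hle : (cyclicSubrepresentation (ρ.comp ι) v).toSubmodule ≤ W :=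
    Submodule.span_mono (Set.range_comp_subset_range ι fun g => ρ g v)
  have hbx : b x ∈ W := (W.smul_mem_iff hx).mp
    (hle (repr_smul_mem_cyclicSubrepresentation (ρ := ρ.comp ι) b hψ hdiag v x))
  refine top_unique (b.span_eq.ge.trans (Submodule.span_le.mpr (Set.range_subset_iff.mpr ?_)))
  intro y
  obtain ⟨g, c, hc, hg⟩ := htrans x y
  exact (W.smul_mem_iff hc).mp
    (hg ▸ (cyclicSubrepresentation ρ v).apply_mem_toSubmodule g hbx)

end IrreducibleRepresentations

noncomputable section

section InducedRepresentation

variable {G : Type*} [Group G] {A : Subgroup G}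

/-- The `A`-valued cocycle of the action of `G` on `G ⧸ A` determined by the coset representatives
`Quotient.out`: it measures by how much `g` carries the representative of `g⁻¹ • x` away from that
of `x`. -/
def cosetCocycle (g : G) (x : G ⧸ A) : A :=
  ⟨x.out⁻¹ * (g * (g⁻¹ • x).out), QuotientGroup.eq.mp (by
    rw [QuotientGroup.out_eq', ← smul_eq_mul, ← MulAction.Quotient.smul_coe,
      QuotientGroup.out_eq', smul_inv_smul])⟩

theorem cosetCocycle_one (x : G ⧸ A) : cosetCocycle 1 x = 1 :=
  Subtype.ext (by simp [cosetCocycle])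

theorem cosetCocycle_mul (g h : G) (x : G ⧸ A) :
    cosetCocycle (g * h) x = cosetCocycle g x * cosetCocycle h (g⁻¹ • x) :=
  Subtype.ext (by simp [cosetCocycle, mul_smul, mul_assoc])

theorem coe_smul_quotient [A.Normal] (a : A) (x : G ⧸ A) : (a : G) • x = x := by
  induction x using QuotientGroup.induction_on with
  | H g =>
    rw [MulAction.Quotient.smul_coe, smul_eq_mul, eq_comm, QuotientGroup.eq]
    simpa [mul_assoc] using (inferInstance : A.Normal).conj_mem a a.2 g⁻¹

theorem cosetCocycle_coe [A.Normal] (a : A) (x : G ⧸ A) :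
    cosetCocycle (a : G) x = MulAut.conjNormal x.out⁻¹ a := by
  have hx : (a : G)⁻¹ • x = x := coe_smul_quotient a⁻¹ x
  exact Subtype.ext (by simp [cosetCocycle, hx, mul_assoc])

/-- The representation of `G` induced from the character `χ` of `A`, realised on functions on
`G ⧸ A` by means of `cosetCocycle`. -/
def inducedRepresentation (χ : A →* Circle) :
    Representation ℂ G (EuclideanSpace ℂ (G ⧸ A)) where
  toFun g :=
    { toFun := fun f => WithLp.toLp 2 fun x => (χ (cosetCocycle g x) : ℂ) * f (g⁻¹ • x)
      map_add' := fun f f' => by ext x; simp [mul_add]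
      map_smul' := fun c f => by ext x; simp [mul_left_comm] }
  map_one' := by ext f x; simp [cosetCocycle_one]
  map_mul' g h := by ext f x; simp [cosetCocycle_mul, mul_smul, mul_assoc]

theorem inducedRepresentation_apply (χ : A →* Circle) (g : G) (f : EuclideanSpace ℂ (G ⧸ A))
    (x : G ⧸ A) :
    inducedRepresentation χ g f x = (χ (cosetCocycle g x) : ℂ) * f (g⁻¹ • x) := rfl

theorem inducedRepresentation_single [DecidableEq (G ⧸ A)] (χ : A →* Circle) (g : G) (x : G ⧸ A) :
    inducedRepresentation χ g (EuclideanSpace.single x 1) =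
      (χ (cosetCocycle g (g • x)) : ℂ) • EuclideanSpace.single (g • x) 1 := by
  ext y
  by_cases hy : y = g • x
  · simp [hy, inducedRepresentation_apply]
  · simp [hy, inducedRepresentation_apply, inv_smul_eq_iff]

theorem norm_inducedRepresentation_apply [Fintype (G ⧸ A)] (χ : A →* Circle) (g : G)
    (f : EuclideanSpace ℂ (G ⧸ A)) : ‖inducedRepresentation χ g f‖ = ‖f‖ := by
  simp only [EuclideanSpace.norm_eq, inducedRepresentation_apply, norm_mul, Circle.norm_coe,
    one_mul]
  exact congrArg Real.sqrt (Equiv.sum_comp (MulAction.toPerm g⁻¹) fun x => ‖f x‖ ^ 2)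

/-- Some character `χ` of `A` has a free orbit under the conjugation action of `G ⧸ A`, i.e. its
stabilizer in `G` is `A`. -/
def HasFreeCharacterOrbit (A : Subgroup G) [A.Normal] : Prop :=
  ∃ χ : A →* Circle, ∀ g : G, χ.comp (MulAut.conjNormal g).toMonoidHom = χ → g ∈ A

/-- The conjugates of a character `χ` of `A`, indexed by `G ⧸ A`: they are the characters
by which `A` acts on the coordinate lines of the induced representation of `χ`. -/
def conjCharacter [A.Normal] (χ : A →* Circle) (x : G ⧸ A) : A →* ℂ :=
  Circle.coeHom.comp (χ.comp (MulAut.conjNormal x.out⁻¹).toMonoidHom)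

theorem conjCharacter_apply [A.Normal] (χ : A →* Circle) (x : G ⧸ A) (a : A) :
    conjCharacter χ x a = (χ (MulAut.conjNormal x.out⁻¹ a) : ℂ) := rfl

theorem conjCharacter_injective [A.Normal] {χ : A →* Circle}
    (hχ : ∀ g : G, χ.comp (MulAut.conjNormal g).toMonoidHom = χ → g ∈ A) :
    Function.Injective (conjCharacter (G := G) χ) := by
  intro x y hxy
  rw [← QuotientGroup.out_eq' x, ← QuotientGroup.out_eq' y, QuotientGroup.eq]
  refine hχ _ (MonoidHom.ext fun a => Circle.ext ?_)
  simpa [conjCharacter_apply] using DFunLike.congr_fun hxy (MulAut.conjNormal y.out a)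

theorem isIrreducible_inducedRepresentation [A.Normal] [A.FiniteIndex] {χ : A →* Circle}
    (hχ : ∀ g : G, χ.comp (MulAut.conjNormal g).toMonoidHom = χ → g ∈ A) :
    (inducedRepresentation χ).IsIrreducible := by
  classical
  let _ := A.fintypeQuotientOfFiniteIndex
  refine isIrreducible_of_monomial (EuclideanSpace.basisFun (G ⧸ A) ℂ).toBasis A.subtype
    (conjCharacter_injective hχ) (fun a x => ?_) fun x y => ?_
  · have hx : (a : G) • x = x := coe_smul_quotient a x
    simp [inducedRepresentation_single, hx, cosetCocycle_coe, conjCharacter_apply]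
  · obtain ⟨g, rfl⟩ := MulAction.exists_smul_eq G x y
    exact ⟨g, χ (cosetCocycle g (g • x)), Circle.coe_ne_zero _,
      by simp [inducedRepresentation_single]⟩

end InducedRepresentation

section Unitary

variable {𝕜 G E : Type*} [RCLike 𝕜] [Group G] [NormedAddCommGroup E] [InnerProductSpace 𝕜 E]
  [CompleteSpace E]

/-- A norm-preserving representation of a group on a Hilbert space, as a homomorphism to the
unitary group. -/
def unitaryOfNormEq (ρ : Representation 𝕜 G E) (hρ : ∀ g v, ‖ρ g v‖ = ‖v‖) :
    G →* unitary (E →L[𝕜] E) where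
  toFun g := Unitary.linearIsometryEquiv.symm
    { LinearMap.GeneralLinearGroup.generalLinearEquiv 𝕜 E (MonoidHom.toHomUnits ρ g) with
      norm_map' := hρ g }
  map_one' := by ext v; exact LinearMap.congr_fun (map_one ρ) v
  map_mul' g h := by ext v; exact LinearMap.congr_fun (map_mul ρ g h) v

end Unitary

/-- The unitary representation of `G` induced from the character `χ` of `A`. -/
def inducedUnitaryRep {G : Type*} [Group G] {A : Subgroup G} [A.FiniteIndex] (χ : A →* Circle) :
    UnitaryRep G :=
  let _ := A.fintypeQuotientOfFiniteIndex
  { space := EuclideanSpace ℂ (G ⧸ A)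
    hom := unitaryOfNormEq (inducedRepresentation χ) (norm_inducedRepresentation_apply χ) }

namespace GroupCStar

variable {G H : Type*} [Group G] [Group H]

/-- The canonical homomorphism from `G` to `C*(G)`. -/
def of : G →* GroupCStar G where
  toFun g := show groupCStarSubalgebra G from ⟨universalRep g,
    StarSubalgebra.le_topologicalClosure _ (StarAlgebra.subset_adjoin ℂ _ ⟨g, rfl⟩)⟩
  map_one' := (isometry_incl G).injective (map_one universalRep)
  map_mul' g h := (isometry_incl G).injective (map_mul universalRep g h)

theorem incl_of (g : G) : incl G (of g) = universalRep g := rfl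

theorem dense_span_range_of :
    Dense (Submodule.span ℂ (Set.range (of (G := G))) : Set (GroupCStar G)) := by
  have hrange : Set.range (universalRepAlg G) ⊆
      incl G '' Submodule.span ℂ (Set.range (of (G := G))) := by
    rintro _ ⟨f, rfl⟩
    refine ⟨f.coeff.sum fun g c => c • of g, Submodule.sum_mem _ fun g _ =>
      Submodule.smul_mem _ _ (Submodule.subset_span ⟨g, rfl⟩), ?_⟩
    simp [universalRepAlg, MonoidAlgebra.lift_apply, map_finsuppSum, incl_of]
  intro x
  rw [(isometry_incl G).isUniformInducing.isInducing.closure_eq_preimage_closure_image]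
  refine closure_mono hrange ?_
  rw [← coe_groupCStarSubalgebra, ← range_incl]
  exact ⟨x, rfl⟩

section Restrict

variable {V : Type*} [NormedAddCommGroup V] [InnerProductSpace ℂ V] [CompleteSpace V]
  [FiniteDimensional ℂ V]

/-- The representation of `G` obtained by restricting a representation of `C*(G)`. -/
def restrict (σ : GroupCStar G →⋆ₐ[ℂ] (V →L[ℂ] V)) : Representation ℂ G V :=
  (ContinuousLinearMap.toLinearMapRingHom : (V →L[ℂ] V) →+* _).toMonoidHom.comp
    ((σ : GroupCStar G →* (V →L[ℂ] V)).comp of)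

open scoped CStarAlgebra in
theorem coe_cyclicSubrepresentation_restrict (σ : GroupCStar G →⋆ₐ[ℂ] (V →L[ℂ] V)) (v : V) :
    (cyclicSubrepresentation (restrict σ) v : Set V) = Set.range fun x => σ x v := by
  let ev : GroupCStar G →L[ℂ] V :=
    (ContinuousLinearMap.apply ℂ V v).comp ⟨σ.toAlgHom.toLinearMap, map_continuous σ⟩
  let W := (cyclicSubrepresentation (restrict σ) v).toSubmodule
  have hW : W = (Submodule.span ℂ (Set.range of)).map (ev : GroupCStar G →ₗ[ℂ] V) := by
    rw [Submodule.map_span, ← Set.range_comp]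
    rfl
  refine Set.Subset.antisymm ?_ (Set.range_subset_iff.mpr fun x => ?_)
  · change (W : Set V) ⊆ _
    rw [hW, Submodule.map_coe]
    exact Set.image_subset_range _ _
  · exact dense_span_range_of.induction (P := fun x => ev x ∈ W)
      (fun x hx => hW ▸ Submodule.mem_map_of_mem hx)
      (W.closed_of_finiteDimensional.preimage ev.continuous) x

theorem isIrreducible_restrict_comp {σ : GroupCStar H →⋆ₐ[ℂ] (V →L[ℂ] V)}
    (hσ : (restrict σ).IsIrreducible) {φ : GroupCStar G →⋆ₐ[ℂ] GroupCStar H}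
    (hφ : Function.Surjective φ) : (restrict (σ.comp φ)).IsIrreducible := by
  rw [isIrreducible_iff_forall_cyclicSubrepresentation_eq_top] at hσ ⊢
  refine ⟨hσ.1, fun v hv => SetLike.coe_injective ?_⟩
  calc (cyclicSubrepresentation (restrict (σ.comp φ)) v : Set V)
      = Set.range ((fun y => σ y v) ∘ φ) := coe_cyclicSubrepresentation_restrict _ v
    _ = Set.range fun y => σ y v := hφ.range_comp _
    _ = cyclicSubrepresentation (restrict σ) v := (coe_cyclicSubrepresentation_restrict σ v).symm
    _ = (⊤ : Subrepresentation (restrict σ)) := by rw [hσ.2 v hv]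

end Restrict

/-- The extension of a unitary representation of `G` to `C*(G)`. -/
def extend (π : UnitaryRep G) : GroupCStar G →⋆ₐ[ℂ] π.Op :=
  (UniversalOp.component π).comp (incl G)

theorem index_le_of_surjective {φ : GroupCStar G →⋆ₐ[ℂ] GroupCStar H}
    (hφ : Function.Surjective φ) (A : Subgroup G) [IsMulCommutative A] [A.FiniteIndex]
    {B : Subgroup H} [B.Normal] [B.FiniteIndex] (hB : HasFreeCharacterOrbit B) :
    B.index ≤ A.index := by
  obtain ⟨χ, hχ⟩ := hB
  have hirr : (restrict (extend (inducedUnitaryRep χ))).IsIrreducible :=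
    isIrreducible_inducedRepresentation hχ
  let _ := B.fintypeQuotientOfFiniteIndex
  have : FiniteDimensional ℂ (inducedUnitaryRep χ).space :=
    inferInstanceAs (FiniteDimensional ℂ (EuclideanSpace ℂ (H ⧸ B)))
  calc B.index = Module.finrank ℂ (EuclideanSpace ℂ (H ⧸ B)) := by
        rw [finrank_euclideanSpace, Subgroup.index, Nat.card_eq_fintype_card]
    _ ≤ A.index := finrank_le_index_of_isIrreducible (isIrreducible_restrict_comp hirr hφ) A

end GroupCStar

theorem GroupLatticePair.IsCrystalLike.hasFreeCharacterOrbit {G : Type*} [Group G]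
    {P : GroupLatticePair G} (hP : P.IsCrystalLike) : HasFreeCharacterOrbit P.lattice := by
  obtain ⟨χ, hχ⟩ := hP
  have hinj : Function.Injective fun d : P.pointGroup => P.pointGroupAction d χ := by
    rw [← Set.injOn_univ, ← Set.ncard_image_iff, Set.image_univ, Set.ncard_univ]
    exact hχ
  refine ⟨χ, fun g hg => ?_⟩
  have hfix : P.pointGroupAction ((g⁻¹ : G) : P.pointGroup) χ = P.pointGroupAction 1 χ :=
    calc P.pointGroupAction ((g⁻¹ : G) : P.pointGroup) χ
        = χ.comp (MulAut.conjNormal g⁻¹⁻¹).toMonoidHom := rfl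
      _ = χ := by rw [inv_inv, hg]
      _ = P.pointGroupAction 1 χ := by rw [map_one, Equiv.Perm.one_apply]
  exact inv_mem_iff.mp ((QuotientGroup.eq_one_iff _).mp (hinj hfix))

end

theorem corollary4p14_general {G H : Type*} [Group G] [Group H]
    (hiso : Nonempty (GroupCStar G ≃⋆ₐ[ℂ] GroupCStar H))
    (A : Subgroup G) [A.Normal] [IsMulCommutative A] [A.FiniteIndex]
    (B : Subgroup H) [B.Normal] [IsMulCommutative B] [B.FiniteIndex]
    (hA : HasFreeCharacterOrbit A) (hB : HasFreeCharacterOrbit B) : A.index = B.index := by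
  obtain ⟨φ⟩ := hiso
  exact le_antisymm
    (GroupCStar.index_le_of_surjective (φ := (φ.symm : GroupCStar H →⋆ₐ[ℂ] GroupCStar G))
      φ.symm.surjective B hA)
    (GroupCStar.index_le_of_surjective (φ := (φ : GroupCStar G →⋆ₐ[ℂ] GroupCStar H))
      φ.surjective A hB)

theorem corollary4p14 {G : Type*} {H : Type*} [Group G] [Group H] [Group.FG G] [Group.FG H]
    (hiso : Nonempty (GroupCStar G ≃⋆ₐ[ℂ] GroupCStar H))
    (P : GroupLatticePair G) (Q : GroupLatticePair H)
    (hP : P.IsCrystalLike) (hQ : Q.IsCrystalLike) :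
    P.lattice.index = Q.lattice.index ∧ Nat.card P.pointGroup = Nat.card Q.pointGroup := by
  have h := corollary4p14_general hiso P.lattice Q.lattice hP.hasFreeCharacterOrbit
    hQ.hasFreeCharacterOrbit
  exact ⟨h, h⟩
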